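/- Let $d\ge 1$, $L=\{1,\dots,d\}$, let $\theta\in\mathbb R^d$ satisfy $\theta_i<0$ for all $i$, let $\Sigma$ be a symmetric positive definite $d\times d$ matrix, $D=\Sigma^{-1}$, $|u|_D=\sqrt{\langle u,Du\rangle}$, and let $R$ be a nonsingular $\mathcal M$-matrix, i.e. $R=\mu\mathbb I_d-A$ with $A$ entrywise nonnegative and $\mu$ larger than the spectral radius of $A$. For a continuous $\psi:[0,\infty)\to\mathbb R^d$ with $\psi(0)\in\mathbb R^d_+$, let $\Gamma(\psi)$ be the set of continuous $\phi:[0,\infty)\to\mathbb R^d_+$ for which there is a continuous $\eta:[0,\infty)\to\mathbb R^d_+$ with $\phi=\psi+R\eta$ such that, for each $i$, $\eta_i(0)=0$, $\eta_i$ is nondecreasing and $\int_0^\infty\phi_i\,d\eta_i=0$. For $K\subseteq L$ let $F_K=\{x\in\mathbb R^d_+: x_i=0\ (i\in K),\ x_j>0\ (j\in L\setminus K)\}$. A pair $w,v\in\mathbb R^d_+$ is called admissible for $K$ if $w\ne v$, $w_i=v_i=0$ for $i\in K$, and for each $j\notin K$ $w_j\ne0$ or $v_j\neq0$. For such a pair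 define the locally optimal cost $$\mathcal I^*_K(w,v)=\inf\ \frac12\int_0^{\tau_\phi(v)}|\dot\psi(t)-\theta|_D^2\,dt,\qquad \tau_\phi(v)=\inf\{t\ge0:\phi(t)=v\},$$ where the infimum is over all (locally) absolutely continuous $\psi:[0,\infty)\to\mathbb R^d$ with $\psi(0)=w$ and all $\phi\in\Gamma(\psi)$ with $\tau_\phi(v)<\infty$ and $\phi(t)\in F_K$ for all $t\in(0,\tau_\phi(v))$. For $u\neq 0$ with $u_i=0$ for $i\in K$, let $\mathcal I^*_K(u)$ be the infimum of $\mathcal I^*_K(w,v)$ over the admissible pairs with $v-w=u$ (the value is in fact the same for all these pairs). Let $$\mathbb D_K=\Big\{v\in\mathbb R^d:\ v_i=0\ \forall i\in K,\ \ \sum_{i=1}^d|v_i|=1,\ \ v_j\ge0\text{ for some }j\in L\setminus K\Big\}.$$ Then there is $\varepsilon>0$ such that $\mathcal I^*_K(v)>\varepsilon$ for all $K\subseteq L$ and all $v\in\mathbb D_K$. Consequently, for every norm $T$ on $\mathbb R^d$ that is monotone on $\mathbb R^d_+$ ($0\le x\le y$ implies $T(x)\le T(y)$), the constant $$\mathbf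 r=\sup\Big\{\frac{T(v)}{\mathcal I^*_K(v)}:\ K\subsetneq L,\ v\in\mathbb D_K\Big\}$$ is finite. -/

import Mathlib

open scoped ENNReal

noncomputable section

namespace SRBM

/-- A nonsingular `M`-matrix: `R = μ I - A` with `A` entrywise nonnegative and `μ` strictly larger
than the spectral radius of `A` (over the complex numbers). -/
def IsNonsingularMMatrix {d : ℕ} (R : Matrix (Fin d) (Fin d) ℝ) : Prop :=
  ∃ (μ : ℝ) (A : Matrix (Fin d) (Fin d) ℝ),
    (∀ i j, 0 ≤ A i j) ∧
    spectralRadius ℂ (A.map (algebraMap ℝ ℂ)) < ENNReal.ofReal μ ∧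
    R = μ • (1 : Matrix (Fin d) (Fin d) ℝ) - A

/-- The norm `|u|_A = √⟨u, A u⟩` attached to a positive definite matrix `A`. -/
def weightedNorm {d : ℕ} (A : Matrix (Fin d) (Fin d) ℝ) (u : Fin d → ℝ) : ℝ :=
  Real.sqrt (u ⬝ᵥ A.mulVec u)

/-- The Stieltjes function of a continuous nondecreasing function on `[0, ∞)`, extended to the left
of `0` by its value at `0` (so that the associated measure `dg` is carried by `(0, ∞)`). -/
def stieltjesOf (g : ℝ → ℝ) (hm : MonotoneOn g (Set.Ici 0)) (hc : ContinuousOn g (Set.Ici 0)) :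
    StieltjesFunction ℝ where
  toFun t := g (max t 0)
  mono' s t hst :=
    hm (Set.mem_Ici.2 (le_max_right s 0)) (Set.mem_Ici.2 (le_max_right t 0)) (max_le_max_right 0 hst)
  right_continuous' _ :=
    (hc.comp_continuous (continuous_id.max continuous_const)
      (fun t => le_max_right t 0)).continuousWithinAt

/-- `(φ, η)` solves the Skorokhod problem for `ψ` with reflection matrix `R`. Paths are functions on
`ℝ` of which only the restriction to `[0, ∞)` matters. -/
structure IsSkorokhodSolution {d : ℕ} (R : Matrix (Fin d) (Fin d) ℝ)
    (ψ φ η : ℝ → Fin d → ℝ) : Prop where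
  phi_cont : ContinuousOn φ (Set.Ici 0)
  phi_nonneg : ∀ t, 0 ≤ t → ∀ i, 0 ≤ φ t i
  phi_eq : ∀ t, 0 ≤ t → φ t = ψ t + R.mulVec (η t)
  eta_zero : ∀ i, η 0 i = 0
  eta_mono : ∀ i, MonotoneOn (fun t => η t i) (Set.Ici 0)
  eta_cont : ∀ i, ContinuousOn (fun t => η t i) (Set.Ici 0)
  /-- `∫₀^∞ φᵢ(t) dηᵢ(t) = 0`; the integrand is nonnegative. -/
  complementarity : ∀ i,
    ∫⁻ t in Set.Ici 0, ENNReal.ofReal (φ t i)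
      ∂(stieltjesOf (fun t => η t i) (eta_mono i) (eta_cont i)).measure = 0

/-- `Γ(ψ)`: the set of reflected paths `φ` of the input path `ψ`. -/
def regulation {d : ℕ} (R : Matrix (Fin d) (Fin d) ℝ) (ψ : ℝ → Fin d → ℝ) :
    Set (ℝ → Fin d → ℝ) :=
  {φ | ∃ η, IsSkorokhodSolution R ψ φ η}

/-- Paths that are absolutely continuous on every `[0, T]` and start at `w`. -/
def acPaths {d : ℕ} (w : Fin d → ℝ) : Set (ℝ → Fin d → ℝ) :=
  {ψ | (∀ T : ℝ, 0 ≤ T → AbsolutelyContinuousOnInterval ψ 0 T) ∧ ψ 0 = w}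

/-- The face `F_K` of the orthant. -/
def face {d : ℕ} (K : Finset (Fin d)) : Set (Fin d → ℝ) :=
  {x | (∀ i ∈ K, x i = 0) ∧ ∀ j ∉ K, 0 < x j}

/-- The path `φ` reaches `v`, i.e. `τ_φ(v) < ∞`. -/
def Hits {d : ℕ} (φ : ℝ → Fin d → ℝ) (v : Fin d → ℝ) : Prop :=
  ∃ t : ℝ, 0 ≤ t ∧ φ t = v

/-- `τ_φ(v) = inf {t ≥ 0 : φ(t) = v}`, used only for paths that reach `v`. -/
def hittingTime {d : ℕ} (φ : ℝ → Fin d → ℝ) (v : Fin d → ℝ) : ℝ :=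
  sInf {t : ℝ | 0 ≤ t ∧ φ t = v}

/-- `½ ∫₀^τ |ψ'(t) - θ|²_D dt` with `D = S⁻¹`, with values in `[0, ∞]`. -/
def pathCost {d : ℕ} (θ : Fin d → ℝ) (S : Matrix (Fin d) (Fin d) ℝ) (ψ : ℝ → Fin d → ℝ)
    (τ : ℝ) : ℝ≥0∞ :=
  (1 / 2) * ∫⁻ t in Set.Ioo 0 τ, ENNReal.ofReal (weightedNorm S⁻¹ (deriv ψ t - θ) ^ 2)

/-- The condition on pairs `w, v` of points of the orthant with respect to `K`. -/
def PairCondition {d : ℕ} (K : Finset (Fin d)) (w v : Fin d → ℝ) : Prop :=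
  (∀ i, 0 ≤ w i) ∧ (∀ i, 0 ≤ v i) ∧ w ≠ v ∧ (∀ i ∈ K, w i = 0 ∧ v i = 0) ∧
    ∀ j ∉ K, w j ≠ 0 ∨ v j ≠ 0

/-- The locally optimal cost `I*_K(w, v)` from `w` to `v` with path constrained to `F_K`. -/
def localCost {d : ℕ} (θ : Fin d → ℝ) (S R : Matrix (Fin d) (Fin d) ℝ) (K : Finset (Fin d))
    (w v : Fin d → ℝ) : ℝ≥0∞ :=
  ⨅ (ψ ∈ acPaths w) (φ ∈ regulation R ψ) (_ : Hits φ v)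
    (_ : ∀ t ∈ Set.Ioo 0 (hittingTime φ v), φ t ∈ face K),
    pathCost θ S ψ (hittingTime φ v)

/-- The locally optimal cost `I*_K(u)` of a displacement `u`: the value `I*_K(w, v)` at the
admissible pairs with `v - w = u`. That value is the same for all such pairs; the infimum is taken
over all of them, so that a lower bound for it is a lower bound for each. -/
def localCostDir {d : ℕ} (θ : Fin d → ℝ) (S R : Matrix (Fin d) (Fin d) ℝ) (K : Finset (Fin d))
    (u : Fin d → ℝ) : ℝ≥0∞ :=
  ⨅ (w : Fin d → ℝ) (v : Fin d → ℝ) (_ : PairCondition K w v) (_ : v - w = u),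
    localCost θ S R K w v

/-- The direction set `D_K`. -/
def directionSet {d : ℕ} (K : Finset (Fin d)) : Set (Fin d → ℝ) :=
  {v | (∀ i ∈ K, v i = 0) ∧ ∑ i, |v i| = 1 ∧ ∃ j ∉ K, 0 ≤ v j}

/-- The scaling constant `r`: the largest ratio `T(v) / I*_K(v)` over `K ⊊ L` and `v ∈ D_K`. -/
def scalingConstant {d : ℕ} (θ : Fin d → ℝ) (S R : Matrix (Fin d) (Fin d) ℝ)
    (T : (Fin d → ℝ) → ℝ) : ℝ≥0∞ :=
  ⨆ (K : Finset (Fin d)) (_ : K ⊂ Finset.univ) (v ∈ directionSet K),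
    ENNReal.ofReal (T v) / localCostDir θ S R K v

end SRBM

end

namespace SRBM

open Filter Topology Matrix MeasureTheory

-- For a path with displacement `u` reaching its target at time `τ`, put `a = ψ τ - ψ 0 - τ • θ = u
-- - R *ᵥ η τ - τ • θ`. Jensen's inequality bounds the cost below by `a i ^ 2 / (2 * S i i * τ)` for
-- every `i`. If `‖a‖ ≥ δ * (1 + τ)`, then `(1 + τ) ^ 2 ≥ 4 * τ` makes `τ` cancel and leaves a
-- uniform bound.
--
-- That estimate is `exists_drift_bound`. Complementarity makes `η τ` vanish off `K`, so reflection
-- cannot push a free coordinate up. A free `j` with `u j ≥ 0` thus has `a j ≥ -τ * θ j`, and `τ` is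
-- controlled by `‖a‖`. On `K`, where `u = 0`, this bounds `R *ᵥ η τ` above; inverse positivity of
-- `R` then bounds `η τ`, and hence `u`.

-- M-matrices and the drift bound

attribute [local instance] Matrix.linftyOpNormedRing Matrix.linftyOpNormedAlgebra in
theorem exists_norm_pow_map_mulVec_le {d : ℕ} {A : Matrix (Fin d) (Fin d) ℝ} {μ : ℝ}
    (h : spectralRadius ℂ (A.map (algebraMap ℝ ℂ)) < ENNReal.ofReal μ) :
    ∃ r : ℝ, 0 ≤ r ∧ r < μ ∧ ∀ᶠ n : ℕ in atTop, ∀ z : Fin d → ℝ, ‖(A ^ n) *ᵥ z‖ ≤ r ^ n * ‖z‖ := by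
  obtain ⟨r, hr1, hr2⟩ := ENNReal.lt_iff_exists_nnreal_btwn.1 h
  refine ⟨r, r.2, ?_, ?_⟩
  · rw [← ENNReal.ofReal_coe_nnreal] at hr2
    exact (ENNReal.ofReal_lt_ofReal_iff_of_nonneg r.2).1 hr2
  have hev := (spectrum.pow_nnnorm_pow_one_div_tendsto_nhds_spectralRadius
    (A.map (algebraMap ℝ ℂ))).eventually_lt_const hr1
  filter_upwards [hev, eventually_gt_atTop 0] with n hn hn0 z
  have hn0' : (0 : ℝ) < n := by exact_mod_cast hn0
  have h1 : ‖(A.map (algebraMap ℝ ℂ)) ^ n‖ ≤ (r : ℝ) ^ n := by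
    have := ENNReal.rpow_le_rpow hn.le hn0'.le
    rw [← ENNReal.rpow_mul, one_div_mul_cancel hn0'.ne', ENNReal.rpow_one,
      ENNReal.rpow_natCast] at this
    exact_mod_cast this
  have h2 : (A.map (algebraMap ℝ ℂ)) ^ n *ᵥ (fun i => (z i : ℂ))
      = fun i => (((A ^ n) *ᵥ z) i : ℂ) := by
    rw [← Matrix.map_pow]
    ext i
    simp [Matrix.mulVec, dotProduct]
  have h3 : ∀ x : Fin d → ℝ, ‖(fun i => (x i : ℂ))‖ = ‖x‖ := fun x => by
    simp [Pi.norm_def, Complex.nnnorm_real]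
  rw [← h3, ← h2, ← h3 z]
  exact (Matrix.linfty_opNorm_mulVec _ _).trans (by gcongr)

/-- From `A z ≤ μ z` and `A ≥ 0`, iteration gives `A ^ n z ≤ μ ^ n z`. By Gelfand's formula `A ^ n z
/ μ ^ n` tends to `0`, which forces `z ≥ 0`. -/
theorem IsNonsingularMMatrix.nonneg_of_mulVec_nonneg {d : ℕ} {R : Matrix (Fin d) (Fin d) ℝ}
    (hR : IsNonsingularMMatrix R) {z : Fin d → ℝ} (hz : 0 ≤ R *ᵥ z) : 0 ≤ z := by
  obtain ⟨μ, A, hA, hμ, rfl⟩ := hR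
  obtain ⟨r, hr0, hrμ, hev⟩ := exists_norm_pow_map_mulVec_le hμ
  have hμ0 : 0 < μ := hr0.trans_lt hrμ
  have hstep : A *ᵥ z ≤ μ • z := by
    rw [Matrix.sub_mulVec, Matrix.smul_mulVec, Matrix.one_mulVec] at hz
    exact sub_nonneg.1 hz
  have hpow : ∀ n : ℕ, (A ^ n) *ᵥ z ≤ μ ^ n • z := by
    intro n
    induction n with
    | zero => simp
    | succ n ih =>
      have h1 : A *ᵥ ((A ^ n) *ᵥ z) ≤ A *ᵥ (μ ^ n • z) := fun i => by
        simp only [Matrix.mulVec, dotProduct]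
        exact Finset.sum_le_sum fun j _ => mul_le_mul_of_nonneg_left (ih j) (hA i j)
      rw [Matrix.mulVec_mulVec, ← pow_succ', Matrix.mulVec_smul] at h1
      refine h1.trans ?_
      rw [pow_succ, mul_smul]
      exact smul_le_smul_of_nonneg_left hstep (by positivity)
  intro i
  have hlim : Tendsto (fun n : ℕ => -((r / μ) ^ n * ‖z‖)) atTop (𝓝 (-(0 * ‖z‖))) :=
    ((tendsto_pow_atTop_nhds_zero_of_lt_one (by positivity)
      ((div_lt_one hμ0).2 hrμ)).mul_const _).neg
  rw [zero_mul, neg_zero] at hlim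
  refine le_of_tendsto hlim ?_
  filter_upwards [hev] with n hn
  have h1 := (abs_le.1 ((norm_le_pi_norm ((A ^ n) *ᵥ z) i).trans (hn z))).1
  have h2 := hpow n i
  simp only [Pi.smul_apply, smul_eq_mul] at h2
  have h3 : 0 < μ ^ n := by positivity
  rw [div_pow, div_mul_eq_mul_div, ← neg_div, div_le_iff₀ h3]
  linarith

theorem IsNonsingularMMatrix.offDiag_nonpos {d : ℕ} {R : Matrix (Fin d) (Fin d) ℝ}
    (hR : IsNonsingularMMatrix R) {i j : Fin d} (hij : i ≠ j) : R i j ≤ 0 := by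
  obtain ⟨μ, A, hA, -, rfl⟩ := hR
  simpa [Matrix.one_apply_ne hij] using hA i j

theorem IsNonsingularMMatrix.mulVec_surjective {d : ℕ} {R : Matrix (Fin d) (Fin d) ℝ}
    (hR : IsNonsingularMMatrix R) : Function.Surjective R.mulVec := by
  have hinj : Function.Injective (Matrix.mulVecLin R) := by
    rw [← LinearMap.ker_eq_bot, LinearMap.ker_eq_bot']
    intro z hz
    rw [Matrix.mulVecLin_apply] at hz
    refine le_antisymm ?_ (hR.nonneg_of_mulVec_nonneg hz.ge)
    refine neg_nonneg.1 (hR.nonneg_of_mulVec_nonneg ?_)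
    rw [Matrix.mulVec_neg, hz, neg_zero]
  exact LinearMap.surjective_of_injective hinj

/-- A displacement with a nonnegative free component, corrected by reflection on `K`, stays away
from every multiple of the drift. -/
theorem IsNonsingularMMatrix.exists_drift_bound {d : ℕ} {R : Matrix (Fin d) (Fin d) ℝ}
    (hR : IsNonsingularMMatrix R) {θ : Fin d → ℝ} (hθ : ∀ i, θ i < 0) :
    ∃ δ : ℝ, 0 < δ ∧ ∀ (K : Finset (Fin d)) (u y : Fin d → ℝ) (τ : ℝ), 0 ≤ τ →
      (∀ i ∈ K, u i = 0) → (∃ j ∉ K, 0 ≤ u j) → (∀ i, 0 ≤ y i) → (∀ j ∉ K, y j = 0) →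
      δ * (∑ i, |u i| + τ) ≤ ‖u - R *ᵥ y - τ • θ‖ := by
  obtain ⟨m, hm, hmθ⟩ := Pi.exists_forall_pos_add_lt (x := θ) (y := 0) hθ
  -- Since `R z = 1`, a bound `R y ≤ B` in every coordinate reads `R (B z - y) ≥ 0`, hence `y ≤ B
  -- z`.
  obtain ⟨z, hz⟩ := hR.mulVec_surjective 1
  set ρ : ℝ := ∑ i, ∑ j, |R i j| with hρ
  have hρ0 : 0 ≤ ρ := by positivity
  set C : ℝ := (1 + ρ * ‖z‖) * (1 + ‖θ‖ / m) with hC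
  have hC0 : 0 ≤ C := by positivity
  have hE : 0 < d * C + 1 / m := by positivity
  refine ⟨(d * C + 1 / m)⁻¹, inv_pos.2 hE, ?_⟩
  intro K u y τ hτ huK hj hy hyK
  set a := u - R *ᵥ y - τ • θ with ha
  have hai : ∀ i, a i = u i - (R *ᵥ y) i - τ * θ i := fun i => by simp [ha]
  have hM : ∀ i, |a i| ≤ ‖a‖ := fun i => norm_le_pi_norm a i
  have hΘ : ∀ i, |θ i| ≤ ‖θ‖ := fun i => norm_le_pi_norm θ i
  have hoff : ∀ j ∉ K, (R *ᵥ y) j ≤ 0 := fun j hjK => by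
    simp only [Matrix.mulVec, dotProduct]
    refine Finset.sum_nonpos fun i _ => ?_
    by_cases hij : j = i
    · subst hij; simp [hyK j hjK]
    · exact mul_nonpos_of_nonpos_of_nonneg (hR.offDiag_nonpos hij) (hy i)
  have hτm : τ ≤ ‖a‖ / m := by
    obtain ⟨j, hjK, huj⟩ := hj
    rw [le_div_iff₀ hm]
    have h1 := hoff j hjK
    have h2 := hmθ j
    have h3 := (le_abs_self _).trans (hM j)
    rw [hai] at h3
    simp only [Pi.zero_apply] at h2
    nlinarith
  have hτΘ : τ * ‖θ‖ ≤ ‖a‖ * (‖θ‖ / m) := by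
    calc τ * ‖θ‖ ≤ ‖a‖ / m * ‖θ‖ := by gcongr
      _ = _ := by ring
  have hτθ : ∀ i, |τ * θ i| ≤ τ * ‖θ‖ := fun i => by
    rw [abs_mul, abs_of_nonneg hτ]; exact mul_le_mul_of_nonneg_left (hΘ i) hτ
  set B : ℝ := ‖a‖ * (1 + ‖θ‖ / m) with hB
  have hB0 : 0 ≤ B := by positivity
  have hBge : ‖a‖ + τ * ‖θ‖ ≤ B := by rw [hB]; linarith
  have hRy : ∀ i, (R *ᵥ y) i ≤ B := fun i => by
    by_cases hi : i ∈ K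
    · have h1 := hai i
      rw [huK i hi] at h1
      have h2 := (abs_le.1 (hM i)).1
      have h3 := (abs_le.1 (hτθ i)).1
      linarith
    · exact (hoff i hi).trans hB0
  have hyB : ∀ i, y i ≤ B * ‖z‖ := by
    have h1 : 0 ≤ B • z - y := by
      apply hR.nonneg_of_mulVec_nonneg
      rw [Matrix.mulVec_sub, Matrix.mulVec_smul, hz]
      intro i
      simpa using hRy i
    intro i
    have h2 := h1 i
    simp only [Pi.zero_apply, Pi.sub_apply, Pi.smul_apply, smul_eq_mul] at h2
    have h3 : z i ≤ ‖z‖ := (le_abs_self _).trans (norm_le_pi_norm z i)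
    nlinarith
  have hRyabs : ∀ i, |(R *ᵥ y) i| ≤ ρ * (B * ‖z‖) := fun i => by
    calc |(R *ᵥ y) i| ≤ ∑ j, |R i j * y j| := by
          simp only [Matrix.mulVec, dotProduct]
          exact Finset.abs_sum_le_sum_abs _ _
      _ ≤ ∑ j, |R i j| * (B * ‖z‖) := by
          gcongr with j
          rw [abs_mul, abs_of_nonneg (hy j)]
          exact mul_le_mul_of_nonneg_left (hyB j) (abs_nonneg _)
      _ = (∑ j, |R i j|) * (B * ‖z‖) := by rw [Finset.sum_mul]
      _ ≤ ρ * (B * ‖z‖) := by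
          gcongr
          exact Finset.single_le_sum (f := fun i => ∑ j, |R i j|)
            (fun i _ => Finset.sum_nonneg fun j _ => abs_nonneg _) (Finset.mem_univ i)
  have hu : ∀ i, |u i| ≤ C * ‖a‖ := fun i => by
    have h1 : u i = a i + (R *ᵥ y) i + τ * θ i := by rw [hai]; ring
    rw [h1]
    have h2 := abs_add_three (a i) ((R *ᵥ y) i) (τ * θ i)
    have h3 : C * ‖a‖ = B + ρ * (B * ‖z‖) := by rw [hC, hB]; ring
    linarith [hM i, hRyabs i, hτθ i]
  have hsum : ∑ i, |u i| ≤ d * (C * ‖a‖) := by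
    simpa using Finset.sum_le_sum (s := Finset.univ) fun i _ => hu i
  rw [inv_mul_le_iff₀ hE]
  calc ∑ i, |u i| + τ ≤ d * (C * ‖a‖) + ‖a‖ / m := add_le_add hsum hτm
    _ = _ := by ring

/-! ### Lower bound for the cost -/

/-- Cauchy–Schwarz for the form `S⁻¹` applied to `x` and the `i`-th column of `S`. -/
theorem sq_le_mul_quadraticForm_inv {d : ℕ} {S : Matrix (Fin d) (Fin d) ℝ} (hS : S.PosDef)
    (x : Fin d → ℝ) (i : Fin d) : x i ^ 2 ≤ S i i * (x ⬝ᵥ S⁻¹ *ᵥ x) := by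
  have hd : 0 < S i i := hS.diag_pos
  have hU : IsUnit S.det := hS.det_pos.ne'.isUnit
  have hsymm : S⁻¹ᵀ = S⁻¹ := by
    have := hS.inv.isHermitian
    rwa [Matrix.IsHermitian, Matrix.conjTranspose_eq_transpose_of_trivial] at this
  set e : Fin d → ℝ := S *ᵥ Pi.single i 1 with he
  have hSe : S⁻¹ *ᵥ e = Pi.single i 1 := by
    rw [he, Matrix.mulVec_mulVec, Matrix.nonsing_inv_mul _ hU, Matrix.one_mulVec]
  have h1 : e ⬝ᵥ S⁻¹ *ᵥ x = x i := by
    rw [Matrix.dotProduct_mulVec, ← Matrix.mulVec_transpose, hsymm, hSe]; simp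
  have h2 : e ⬝ᵥ S⁻¹ *ᵥ e = S i i := by rw [hSe]; simp [he]
  have h3 : x ⬝ᵥ S⁻¹ *ᵥ e = x i := by rw [hSe]; simp
  have h0 := hS.inv.posSemidef.dotProduct_mulVec_nonneg (S i i • x - x i • e)
  simp only [star_trivial, Matrix.mulVec_sub, Matrix.mulVec_smul, sub_dotProduct, dotProduct_sub,
    smul_dotProduct, dotProduct_smul, smul_eq_mul, h1, h2, h3] at h0
  have h4 : 0 ≤ S i i * (S i i * (x ⬝ᵥ S⁻¹ *ᵥ x) - x i ^ 2) := by linarith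
  linarith [nonneg_of_mul_nonneg_right h4 hd]

theorem ofReal_integral_le_lintegral_ofReal {α : Type*} [MeasurableSpace α] {ν : Measure α}
    {f : α → ℝ} (hf : Integrable f ν) :
    ENNReal.ofReal (∫ a, f a ∂ν) ≤ ∫⁻ a, ENNReal.ofReal (f a) ∂ν := by
  refine ENNReal.ofReal_le_of_le_toReal ?_
  rw [integral_eq_lintegral_pos_part_sub_lintegral_neg_part hf]
  exact sub_le_self _ ENNReal.toReal_nonneg

theorem absolutelyContinuousOnInterval_apply {d : ℕ} {ψ : ℝ → Fin d → ℝ} {a b : ℝ}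
    (h : AbsolutelyContinuousOnInterval ψ a b) (i : Fin d) :
    AbsolutelyContinuousOnInterval (fun t => ψ t i) a b :=
  squeeze_zero (fun _ => Finset.sum_nonneg fun _ _ => dist_nonneg)
    (fun _ => Finset.sum_le_sum fun _ _ => dist_le_pi_dist _ _ i) h

/-- Jensen's bound: the cost of a path dominates the cost of a coordinate of its mean velocity. -/
theorem sq_div_le_lintegral_weightedNorm_sq {d : ℕ} {S : Matrix (Fin d) (Fin d) ℝ} (hS : S.PosDef)
    (θ : Fin d → ℝ) {ψ : ℝ → Fin d → ℝ} {τ : ℝ} (hτ : 0 < τ)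
    (hψ : AbsolutelyContinuousOnInterval ψ 0 τ) (i : Fin d) :
    ENNReal.ofReal ((ψ τ i - ψ 0 i - τ * θ i) ^ 2 / (S i i * τ)) ≤
      ∫⁻ t in Set.Ioo 0 τ, ENNReal.ofReal (weightedNorm S⁻¹ (deriv ψ t - θ) ^ 2) := by
  have hs : 0 < S i i := hS.diag_pos
  have hac := absolutelyContinuousOnInterval_apply hψ i
  set a := ψ τ i - ψ 0 i - τ * θ i with ha
  set l := a / τ with hl
  set g : ℝ → ℝ := deriv fun t => ψ t i with hg
  have hgi : IntegrableOn g (Set.Ioo 0 τ) := by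
    have := hac.intervalIntegrable_deriv
    rwa [intervalIntegrable_iff_integrableOn_Ioo_of_le hτ.le] at this
  have hgint : ∫ t in Set.Ioo 0 τ, g t = ψ τ i - ψ 0 i := by
    rw [← hac.integral_deriv_eq_sub, intervalIntegral.integral_of_le hτ.le,
      integral_Ioc_eq_integral_Ioo]
  have hconst : ∀ c : ℝ, IntegrableOn (fun _ : ℝ => c) (Set.Ioo 0 τ) := fun c =>
    integrableOn_const (by simp)
  have hconst_int : ∀ c : ℝ, ∫ _ in Set.Ioo 0 τ, c = τ * c := fun c => by
    simp [hτ.le]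
  have hsubi : IntegrableOn (fun t => 2 * l * (g t - θ i)) (Set.Ioo 0 τ) :=
    (hgi.sub (hconst _)).const_mul _
  -- The tangent to the square at the mean `l` lies below it. Being affine in `g`, it is integrable
  -- even when the cost is infinite.
  have hfi : IntegrableOn (fun t => (2 * l * (g t - θ i) - l ^ 2) / S i i) (Set.Ioo 0 τ) :=
    (hsubi.sub (hconst _)).div_const _
  have hfint : ∫ t in Set.Ioo 0 τ, (2 * l * (g t - θ i) - l ^ 2) / S i i = a ^ 2 / (S i i * τ) := by
    rw [integral_div, integral_sub hsubi (hconst _),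
      integral_const_mul, integral_sub hgi (hconst _), hconst_int, hconst_int, hgint, ← ha, hl]
    field_simp
    ring
  rw [← hfint]
  refine (ofReal_integral_le_lintegral_ofReal hfi).trans (lintegral_mono_ae ?_)
  have hdiff := hψ.boundedVariationOn.ae_differentiableAt_of_mem_uIcc
  filter_upwards [ae_restrict_of_ae hdiff, ae_restrict_mem measurableSet_Ioo] with t ht htm
  refine ENNReal.ofReal_le_ofReal ?_
  have hd : DifferentiableAt ℝ ψ t := ht (by
    rw [Set.uIcc_of_le hτ.le]; exact Set.Ioo_subset_Icc_self htm)
  have hgt : g t = deriv ψ t i := ((hasDerivAt_pi.1 hd.hasDerivAt) i).deriv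
  have hq := sq_le_mul_quadraticForm_inv hS (deriv ψ t - θ) i
  have hnn : 0 ≤ (deriv ψ t - θ) ⬝ᵥ S⁻¹ *ᵥ (deriv ψ t - θ) := by
    simpa using hS.inv.posSemidef.dotProduct_mulVec_nonneg (deriv ψ t - θ)
  rw [weightedNorm, Real.sq_sqrt hnn, div_le_iff₀ hs, hgt]
  rw [Pi.sub_apply] at hq
  nlinarith [sq_nonneg (deriv ψ t i - θ i - l)]

/-! ### Reflected paths -/

/-- A regulator coordinate does not move while the corresponding path coordinate is positive. -/
theorem IsSkorokhodSolution.eta_eq_zero {d : ℕ} {R : Matrix (Fin d) (Fin d) ℝ}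
    {ψ φ η : ℝ → Fin d → ℝ} (h : IsSkorokhodSolution R ψ φ η) {τ : ℝ} (hτ : 0 ≤ τ) {j : Fin d}
    (hpos : ∀ t ∈ Set.Ioo 0 τ, 0 < φ t j) : η τ j = 0 := by
  set F := stieltjesOf (fun t => η t j) (h.eta_mono j) (h.eta_cont j) with hF
  have hFcont : Continuous F := (h.eta_cont j).comp_continuous
    (continuous_id.max continuous_const) fun t => le_max_right t 0
  have hφ : ContinuousOn (fun t => φ t j) (Set.Ici 0) := fun t ht =>
    (continuous_apply j).continuousAt.comp_continuousWithinAt (h.phi_cont t ht)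
  have hsub : Set.Ioo 0 τ ⊆ Set.Ici 0 := fun t ht => ht.1.le
  have hae : AEMeasurable (fun t => ENNReal.ofReal (φ t j)) (F.measure.restrict (Set.Ioo 0 τ)) :=
    ((hφ.mono hsub).aemeasurable measurableSet_Ioo).ennreal_ofReal
  have hzero : ∫⁻ t in Set.Ioo 0 τ, ENNReal.ofReal (φ t j) ∂F.measure = 0 :=
    le_antisymm ((lintegral_mono_set hsub).trans (h.complementarity j).le) zero_le
  rw [lintegral_eq_zero_iff' hae] at hzero
  have hnull : F.measure (Set.Ioo 0 τ) = 0 := by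
    have hfalse : ∀ᵐ _ ∂(F.measure.restrict (Set.Ioo 0 τ)), False := by
      filter_upwards [hzero, ae_restrict_mem measurableSet_Ioo] with t ht htm
      exact absurd (hpos t htm) (not_lt.2 (ENNReal.ofReal_eq_zero.1 ht))
    rwa [eventually_false_iff_eq_bot, ae_eq_bot, Measure.restrict_eq_zero] at hfalse
  -- By continuity there is no atom at `τ`, so the open interval carries the whole increment of `η`.
  rw [StieltjesFunction.measure_Ioo, hFcont.continuousWithinAt.leftLim_eq,
    ENNReal.ofReal_eq_zero] at hnull
  have h1 : F τ = η τ j := by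
    change η (max τ 0) j = _
    rw [max_eq_left hτ]
  have h2 : F 0 = 0 := by
    change η (max 0 0) j = _
    rw [max_self, h.eta_zero]
  have h3 : η 0 j ≤ η τ j := h.eta_mono j Set.self_mem_Ici hτ hτ
  rw [h.eta_zero] at h3
  rw [h1, h2] at hnull
  linarith

theorem IsSkorokhodSolution.eta_nonneg {d : ℕ} {R : Matrix (Fin d) (Fin d) ℝ}
    {ψ φ η : ℝ → Fin d → ℝ} (h : IsSkorokhodSolution R ψ φ η) {t : ℝ} (ht : 0 ≤ t) (i : Fin d) :
    0 ≤ η t i :=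
  (h.eta_zero i).symm.le.trans (h.eta_mono i Set.self_mem_Ici ht ht)

theorem IsSkorokhodSolution.phi_zero {d : ℕ} {R : Matrix (Fin d) (Fin d) ℝ}
    {ψ φ η : ℝ → Fin d → ℝ} (h : IsSkorokhodSolution R ψ φ η) : φ 0 = ψ 0 := by
  have h0 : η 0 = 0 := funext h.eta_zero
  rw [h.phi_eq 0 le_rfl, h0, Matrix.mulVec_zero, add_zero]

theorem Hits.hittingTime_mem {d : ℕ} {φ : ℝ → Fin d → ℝ} {v : Fin d → ℝ} (h : Hits φ v)
    (hφ : ContinuousOn φ (Set.Ici 0)) : 0 ≤ hittingTime φ v ∧ φ (hittingTime φ v) = v := by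
  have hclosed : IsClosed {t : ℝ | 0 ≤ t ∧ φ t = v} :=
    hφ.preimage_isClosed_of_isClosed isClosed_Ici isClosed_singleton
  exact hclosed.csInf_mem h ⟨0, fun t ht => ht.1⟩

/-! ### The uniform lower bound and its consequence -/

theorem exists_pos_le_localCostDir {d : ℕ} {θ : Fin d → ℝ} {S R : Matrix (Fin d) (Fin d) ℝ}
    (hS : S.PosDef) (hR : IsNonsingularMMatrix R) (hθ : ∀ i, θ i < 0) :
    ∃ ε : ℝ, 0 < ε ∧ ∀ K : Finset (Fin d), ∀ u ∈ directionSet K,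
      ENNReal.ofReal ε ≤ localCostDir θ S R K u := by
  obtain ⟨δ, hδ, hbound⟩ := hR.exists_drift_bound hθ
  set s : ℝ := 1 + ∑ i, S i i with hs
  have hdiag : ∀ i, 0 < S i i := fun i => hS.diag_pos
  have hs0 : 0 < s := add_pos_of_pos_of_nonneg one_pos (Finset.sum_nonneg fun i _ => (hdiag i).le)
  have hsi : ∀ i, S i i ≤ s := fun i => by
    have := Finset.single_le_sum (f := fun i => S i i) (fun i _ => (hdiag i).le)
      (Finset.mem_univ i)
    rw [hs]; linarith
  refine ⟨2 * δ ^ 2 / s, by positivity, fun K u hu => ?_⟩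
  obtain ⟨huK, husum, huj⟩ := hu
  refine le_iInf fun w => le_iInf fun v => le_iInf fun hwv => le_iInf fun huv => ?_
  refine le_iInf fun ψ => le_iInf fun hψ => le_iInf fun φ => le_iInf fun hφ =>
    le_iInf fun hhit => le_iInf fun hface => ?_
  obtain ⟨η, hη⟩ := hφ
  obtain ⟨hψac, hψ0⟩ := hψ
  obtain ⟨hτ0, hτv⟩ := hhit.hittingTime_mem hη.phi_cont
  set τ := hittingTime φ v
  have hφ0 : φ 0 = w := hη.phi_zero.trans hψ0
  have hτ : 0 < τ := hτ0.lt_of_ne fun h0 => hwv.2.2.1 (by rw [← hφ0, ← hτv, ← h0])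
  have hb := hbound K u (η τ) τ hτ0 huK huj (hη.eta_nonneg hτ0)
    fun j hj => hη.eta_eq_zero hτ0 fun t ht => (hface t ht).2 j hj
  have hψτ : ψ τ - ψ 0 = u - R *ᵥ η τ := by
    rw [← huv, ← hτv, hη.phi_eq τ hτ0, hψ0]; abel
  rw [← hψτ, husum] at hb
  have : Nonempty (Fin d) := ⟨huj.choose⟩
  -- Jensen's bound is applied to the coordinate attaining the sup norm.
  obtain ⟨i, hi⟩ := Finite.exists_max fun i => ‖(ψ τ - ψ 0 - τ • θ) i‖
  have hai : δ * (1 + τ) ≤ |ψ τ i - ψ 0 i - τ * θ i| :=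
    hb.trans ((pi_norm_le_iff_of_nonneg (norm_nonneg _)).2 hi)
  have hsq : (δ * (1 + τ)) ^ 2 ≤ (ψ τ i - ψ 0 i - τ * θ i) ^ 2 := by
    rw [← sq_abs (ψ τ i - ψ 0 i - τ * θ i)]
    exact pow_le_pow_left₀ (by positivity) hai 2
  have hfour : 4 * δ ^ 2 * τ ≤ (δ * (1 + τ)) ^ 2 := by
    nlinarith [mul_nonneg (sq_nonneg δ) (sq_nonneg (1 - τ))]
  have hlow : 4 * δ ^ 2 / s ≤ (ψ τ i - ψ 0 i - τ * θ i) ^ 2 / (S i i * τ) := by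
    rw [div_le_div_iff₀ hs0 (mul_pos (hdiag i) hτ)]
    calc 4 * δ ^ 2 * (S i i * τ) = 4 * δ ^ 2 * τ * S i i := by ring
      _ ≤ (ψ τ i - ψ 0 i - τ * θ i) ^ 2 * s := by
        gcongr
        · exact (hdiag i).le
        · exact hfour.trans hsq
        · exact hsi i
  have hhalf : ENNReal.ofReal (2 * δ ^ 2 / s) = 1 / 2 * ENNReal.ofReal (4 * δ ^ 2 / s) := by
    have h2 : (1 / 2 : ℝ≥0∞) = ENNReal.ofReal (1 / 2) := by
      rw [ENNReal.ofReal_div_of_pos two_pos]; simp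
    rw [h2, ← ENNReal.ofReal_mul (by norm_num)]
    congr 1; ring
  rw [hhalf, pathCost]
  gcongr
  exact (ENNReal.ofReal_le_ofReal hlow).trans
    (sq_div_le_lintegral_weightedNorm_sq hS θ hτ (hψac τ hτ0) i)

theorem seminorm_le_of_mem_directionSet {d : ℕ} (T : Seminorm ℝ (Fin d → ℝ)) {K : Finset (Fin d)}
    {v : Fin d → ℝ} (hv : v ∈ directionSet K) : T v ≤ ∑ i, T (Pi.single i 1) := by
  have hle : ∀ i, |v i| ≤ 1 := fun i => by
    rw [← hv.2.1]
    exact Finset.single_le_sum (f := fun i => |v i|) (fun i _ => abs_nonneg _) (Finset.mem_univ i)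
  calc T v = T (∑ i, v i • Pi.single i (1 : ℝ)) := by rw [← pi_eq_sum_univ' v]
    _ ≤ ∑ i, T (v i • Pi.single i (1 : ℝ)) := Finset.le_sum_of_subadditive T (map_zero T).le (map_add_le_add T) _ _
    _ ≤ ∑ i, T (Pi.single i 1) := by
      gcongr with i
      rw [map_smul_eq_mul, Real.norm_eq_abs]
      exact mul_le_of_le_one_left (apply_nonneg _ _) (hle i)

end SRBM

theorem proposition4p2 {d : ℕ} (θ : Fin d → ℝ) (S R : Matrix (Fin d) (Fin d) ℝ)
    (hS : S.PosDef) (hR : SRBM.IsNonsingularMMatrix R) (hθ : ∀ i, θ i < 0) :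
    (∃ ε : ℝ, 0 < ε ∧ ∀ K : Finset (Fin d), ∀ v ∈ SRBM.directionSet K,
      ENNReal.ofReal ε < SRBM.localCostDir θ S R K v) ∧
    ∀ T : Seminorm ℝ (Fin d → ℝ), (∀ x, T x = 0 → x = 0) →
      (∀ x y : Fin d → ℝ, 0 ≤ x → x ≤ y → T x ≤ T y) →
      SRBM.scalingConstant θ S R T < ⊤ := by
  obtain ⟨ε, hε, hlow⟩ := SRBM.exists_pos_le_localCostDir hS hR hθ
  -- Halving `ε` makes the inequality strict.
  refine ⟨⟨ε / 2, half_pos hε, fun K v hv => lt_of_lt_of_le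
    ((ENNReal.ofReal_lt_ofReal_iff hε).2 (half_lt_self hε)) (hlow K v hv)⟩, fun T _ _ => ?_⟩
  have hfin : ENNReal.ofReal (∑ i, T (Pi.single i 1)) / ENNReal.ofReal ε < ⊤ :=
    ENNReal.div_lt_top ENNReal.ofReal_ne_top (ENNReal.ofReal_pos.2 hε).ne'
  refine lt_of_le_of_lt ?_ hfin
  refine iSup_le fun K => iSup_le fun _ => iSup_le fun v => iSup_le fun hv => ?_
  exact ENNReal.div_le_div
    (ENNReal.ofReal_le_ofReal (SRBM.seminorm_le_of_mem_directionSet T hv)) (hlow K v hv)
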